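/- Let $\mathcal V$ be a locally presentable symmetric monoidal closed category with tensor product $\otimes$, unit object $I$, symmetry $c$ and internal hom $[-,-]$. For a comonoid $C$ and a monoid $A$ in $\mathcal V$, equip $[C,A]$ with its convolution monoid structure, so that $[-,A]\colon \mathbf{Comon}(\mathcal V)^{\mathrm{op}}\to\mathbf{Mon}(\mathcal V)$ is a functor. For monoids $B$ and $A$, a universal measuring comonoid $P(B,A)$ is a comonoid together with a bijection $\mathbf{Comon}(\mathcal V)(C,P(B,A))\cong\mathbf{Mon}(\mathcal V)(B,[C,A])$ natural in the comonoid $C$; let $e\colon P(B,A)\otimes B\to A$ be the transpose of the monoid morphism $B\to[P(B,A),A]$ that corresponds to the identity of $P(B,A)$. The finite dual of $B$ is $B^\circ=P(B,I)$. Let $B$ be a bimonoid, with comultiplication $\Delta_B$ and counit $\varepsilon_B$, and let $A$ be a commutative monoid, with multiplication $\mu_A$ and unit $\iota_A$. Then $P=P(B,A)$ exists, and the comonoid $P$ carries a canonical bimonoid structure, namely a unique bimonoid structure that extends the comonoid structure of $P$ and whose multiplication $m\colon P\otimes P\to P$ and unit $u\colon I\to P$ satisfy $$e\cdot(m\otimes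 B)=\mu_A\cdot(e\otimes e)\cdot(P\otimes c_{P,B}\otimes B)\cdot(P\otimes P\otimes\Delta_B),\qquad e\cdot(u\otimes B)=\iota_A\cdot\varepsilon_B$$ (associativity and unit constraints being omitted). If moreover $B$ is cocommutative, then this bimonoid $P(B,A)$ is commutative. In particular, for every bimonoid $B$ the finite dual $B^\circ$ exists and carries a canonical bimonoid structure (the one above for $A=I$), which is commutative if $B$ is cocommutative. -/

import Mathlib

open CategoryTheory MonoidalCategory MonObj ComonObj

universe v u

namespace Sweedler

noncomputable section

section Convolution

variable {V : Type u} [Category.{v} V] [MonoidalCategory V]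

/-- The unit for the convolution product: in elements, `c ⊗ 1 ↦ ε (c) • 1`. -/
def convOne (C A : V) [ComonObj C] [MonObj A] : C ⊗ 𝟙_ V ⟶ A :=
  (ρ_ C).hom ≫ ε[C] ≫ η[A]

lemma convOne_pre {C A C' : V} [ComonObj C] [MonObj A] [ComonObj C'] (k : C' ⟶ C)
    [IsComonHom k] : k ▷ (𝟙_ V) ≫ convOne C A = convOne C' A := by
  simp [convOne]

variable [SymmetricCategory V]

/-- For a comonoid `C` and a monoid `A`, the convolution product of `f : C ⊗ X ⟶ A` and
`g : C ⊗ Y ⟶ A`: in elements, `c ⊗ (x ⊗ y) ↦ ∑ f (c₁ ⊗ x) * g (c₂ ⊗ y)`. -/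
def convMul {C A X Y : V} [ComonObj C] [MonObj A] (f : C ⊗ X ⟶ A) (g : C ⊗ Y ⟶ A) :
    C ⊗ (X ⊗ Y) ⟶ A :=
  Δ[C] ▷ (X ⊗ Y) ≫ tensorμ C C X Y ≫ (f ⊗ₘ g) ≫ μ[A]

variable {C A X Y Z : V} [ComonObj C] [MonObj A]

lemma convMul_natural {X' Y' : V} (p : X' ⟶ X) (q : Y' ⟶ Y) (f : C ⊗ X ⟶ A) (g : C ⊗ Y ⟶ A) :
    C ◁ (p ⊗ₘ q) ≫ convMul f g = convMul (C ◁ p ≫ f) (C ◁ q ≫ g) := by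
  unfold convMul
  rw [whisker_exchange_assoc, tensorμ_natural_right_assoc, ← tensorHom_comp_tensorHom_assoc]

lemma convMul_pre {C' : V} [ComonObj C'] (k : C' ⟶ C) [IsComonHom k]
    (f : C ⊗ X ⟶ A) (g : C ⊗ Y ⟶ A) :
    k ▷ (X ⊗ Y) ≫ convMul f g = convMul (k ▷ X ≫ f) (k ▷ Y ≫ g) := by
  unfold convMul
  rw [← comp_whiskerRight_assoc, IsComonHom.hom_comul, comp_whiskerRight_assoc,
    tensorμ_natural_left_assoc, ← tensorHom_comp_tensorHom_assoc]

lemma convMul_assoc (f : C ⊗ X ⟶ A) (g : C ⊗ Y ⟶ A) (h : C ⊗ Z ⟶ A) :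
    convMul (convMul f g) h = C ◁ (α_ X Y Z).hom ≫ convMul f (convMul g h) := by
  have e1 : convMul (convMul f g) h =
      (Δ[C] ≫ Δ[C] ▷ C) ▷ ((X ⊗ Y) ⊗ Z) ≫ tensorμ (C ⊗ C) C (X ⊗ Y) Z ≫
        (tensorμ C C X Y ▷ (C ⊗ Z)) ≫ ((f ⊗ₘ g) ⊗ₘ h) ≫ (μ[A] ▷ A) ≫ μ[A] := by
    have := tensorμ_natural_left (Δ[C]) (𝟙 C) (X ⊗ Y) Z
    simp only [id_whiskerRight, tensorHom_id] at this
    rw [comp_whiskerRight_assoc, reassoc_of% this]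
    simp only [convMul, ← tensorHom_id, tensorHom_comp_tensorHom_assoc, Category.id_comp,
      Category.comp_id]
  have e2 : convMul f (convMul g h) =
      (Δ[C] ≫ C ◁ Δ[C]) ▷ (X ⊗ (Y ⊗ Z)) ≫ tensorμ C (C ⊗ C) X (Y ⊗ Z) ≫
        ((C ⊗ X) ◁ tensorμ C C Y Z) ≫ (f ⊗ₘ (g ⊗ₘ h)) ≫ (A ◁ μ[A]) ≫ μ[A] := by
    have := tensorμ_natural_left (𝟙 C) (Δ[C]) X (Y ⊗ Z)
    simp only [id_whiskerRight, id_tensorHom] at this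
    rw [comp_whiskerRight_assoc, reassoc_of% this]
    simp only [convMul, ← id_tensorHom, tensorHom_comp_tensorHom_assoc, Category.id_comp,
      Category.comp_id]
  rw [e1, e2, MonObj.mul_assoc, associator_naturality_assoc, associator_monoidal_assoc,
    MonoidalCategory.tensorHom_def (α_ C C C).hom, Category.assoc, ← comp_whiskerRight_assoc,
    ← whisker_exchange_assoc, whisker_exchange_assoc, Category.assoc, ComonObj.comul_assoc,
    ← whisker_exchange_assoc]

lemma convOne_mul (f : C ⊗ X ⟶ A) :
    convMul (convOne C A) f = C ◁ (λ_ X).hom ≫ f := by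
  have e1 : convMul (convOne C A) f =
      (Δ[C] ≫ ε[C] ▷ C) ▷ (𝟙_ V ⊗ X) ≫ tensorμ (𝟙_ V) C (𝟙_ V) X ≫
        ((λ_ (𝟙_ V)).hom ⊗ₘ f) ≫ (η[A] ▷ A) ≫ μ[A] := by
    have := tensorμ_natural_left (ε[C]) (𝟙 C) (𝟙_ V) X
    simp only [id_whiskerRight, tensorHom_id] at this
    rw [comp_whiskerRight_assoc, reassoc_of% this]
    simp only [convMul, convOne, ← tensorHom_id, tensorHom_comp_tensorHom_assoc,
      Category.id_comp, Category.comp_id]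
    congr 4
    rw [← Category.assoc, ← Category.assoc]
    congr 1
    simp [unitors_equal]
  rw [e1, MonObj.one_mul, ComonObj.counit_comul]
  have := leftUnitor_monoidal C X
  rw [MonoidalCategory.tensorHom_def (λ_ (𝟙_ V)).hom f, Category.assoc, leftUnitor_naturality]
  have h2 := congrArg (· ≫ f) this
  simp only [Category.assoc] at h2
  rw [← h2, MonoidalCategory.tensorHom_def]
  simp

lemma convMul_one (f : C ⊗ X ⟶ A) :
    convMul f (convOne C A) = C ◁ (ρ_ X).hom ≫ f := by
  have e1 : convMul f (convOne C A) =
      (Δ[C] ≫ C ◁ ε[C]) ▷ (X ⊗ 𝟙_ V) ≫ tensorμ C (𝟙_ V) X (𝟙_ V) ≫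
        (f ⊗ₘ (λ_ (𝟙_ V)).hom) ≫ (A ◁ η[A]) ≫ μ[A] := by
    have := tensorμ_natural_left (𝟙 C) (ε[C]) X (𝟙_ V)
    simp only [id_whiskerRight, id_tensorHom] at this
    rw [comp_whiskerRight_assoc, reassoc_of% this]
    simp only [convMul, convOne, ← id_tensorHom, tensorHom_comp_tensorHom_assoc,
      Category.id_comp, Category.comp_id]
    congr 4
    rw [← Category.assoc, ← Category.assoc]
    congr 1
    simp [unitors_equal]
  rw [e1, MonObj.mul_one, ComonObj.comul_counit]
  have := rightUnitor_monoidal C X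
  rw [MonoidalCategory.tensorHom_def' f (λ_ (𝟙_ V)).hom, Category.assoc, rightUnitor_naturality]
  have h2 := congrArg (· ≫ f) this
  simp only [Category.assoc] at h2
  rw [← h2, MonoidalCategory.tensorHom_def]
  simp

end Convolution

variable {V : Type u} [Category.{v} V] [MonoidalCategory V] [SymmetricCategory V]
  [MonoidalClosed V]

open MonoidalClosed

lemma uncurry_conv {C A X Y : V} [ComonObj C] [MonObj A]
    (f : X ⟶ (ihom C).obj A) (g : Y ⟶ (ihom C).obj A) :
    uncurry ((f ⊗ₘ g) ≫ curry (convMul (A := A) ((ihom.ev C).app A) ((ihom.ev C).app A))) =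
      convMul (uncurry f) (uncurry g) := by
  rw [uncurry_natural_left, uncurry_curry, convMul_natural, uncurry_eq, uncurry_eq]

lemma curry_convMul_pre {C C' A : V} [ComonObj C] [ComonObj C'] [MonObj A] (k : C' ⟶ C)
    [IsComonHom k] :
    curry (convMul (A := A) ((ihom.ev C).app A) ((ihom.ev C).app A)) ≫ (pre k).app A =
      ((pre k).app A ⊗ₘ (pre k).app A) ≫
        curry (convMul (A := A) ((ihom.ev C').app A) ((ihom.ev C').app A)) := by
  apply uncurry_injective
  rw [uncurry_pre_app, uncurry_curry, convMul_pre, uncurry_conv, uncurry_pre]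

lemma curry_convOne_pre {C C' A : V} [ComonObj C] [ComonObj C'] [MonObj A] (k : C' ⟶ C)
    [IsComonHom k] :
    curry (convOne C A) ≫ (pre k).app A = curry (convOne C' A) := by
  apply uncurry_injective
  rw [uncurry_pre_app, uncurry_curry, uncurry_curry, convOne_pre]

/-- The convolution monoid structure on the internal hom `[C, A]` of a comonoid `C` and a
monoid `A`. -/
abbrev convMonObj (C A : V) [ComonObj C] [MonObj A] : MonObj ((ihom C).obj A) where
  one := curry (convOne C A)
  mul := curry (convMul (A := A) ((ihom.ev C).app A) ((ihom.ev C).app A))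
  one_mul := by
    apply uncurry_injective
    rw [← tensorHom_id, uncurry_conv, uncurry_curry, convOne_mul, ← uncurry_natural_left,
      Category.comp_id]
  mul_one := by
    apply uncurry_injective
    rw [← id_tensorHom, uncurry_conv, uncurry_curry, convMul_one, ← uncurry_natural_left,
      Category.comp_id]
  mul_assoc := by
    apply uncurry_injective
    rw [← tensorHom_id, uncurry_conv, uncurry_curry, uncurry_natural_left,
      ← id_tensorHom ((ihom C).obj A), uncurry_conv, uncurry_curry, uncurry_id_eq_ev, convMul_assoc]

/-- The convolution monoid `[C, A]` as a bundled monoid. -/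
def convMon (C : Comon V) (A : Mon V) : Mon V :=
  letI := convMonObj C.X A.X
  { X := (ihom C.X).obj A.X }

/-- The contravariant functor `[-, A]` from comonoids to monoids: on morphisms it is
precomposition. -/
def convFunctor (A : Mon V) : (Comon V)ᵒᵖ ⥤ Mon V where
  obj C := convMon C.unop A
  map {C D} k :=
    { hom := (pre k.unop.hom).app A.X
      isMonHom_hom :=
        letI := convMonObj C.unop.X A.X
        letI := convMonObj D.unop.X A.X
        { one_hom := curry_convOne_pre k.unop.hom
          mul_hom := curry_convMul_pre k.unop.hom } }
  map_id C := by
    apply Mon.Hom.ext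
    change (pre (𝟙 _)).app _ = 𝟙 _
    simp
  map_comp {C D E} k l := by
    apply Mon.Hom.ext
    change (pre (l.unop.hom ≫ k.unop.hom)).app _ = (pre _).app _ ≫ (pre _).app _
    simp

/-- The comonoid `P` is a universal measuring comonoid `P(B, A)` of the monoids `B` and `A`: it
comes with a bijection `Comon(V)(C, P) ≅ Mon(V)(B, [C, A])`, natural in the comonoid `C`. -/
abbrev UniversalMeasuring (P : Comon V) (B A : V) [MonObj B] [MonObj A] :=
  (convFunctor (Mon.mk A) ⋙ coyoneda.obj (Opposite.op (Mon.mk B))).RepresentableBy P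

/-- The comonoid `P` is a finite (Sweedler) dual `B° = P(B, I)` of the monoid `B`. -/
abbrev FiniteDual (P : Comon V) (B : V) [MonObj B] :=
  UniversalMeasuring P B (𝟙_ V)

/-- The universal monoid morphism `B ⟶ [P, A]`, the one that corresponds to the identity
of `P`. -/
def UniversalMeasuring.unit {P : Comon V} {B A : V} [MonObj B] [MonObj A]
    (h : UniversalMeasuring P B A) : Mon.mk B ⟶ convMon P (Mon.mk A) :=
  h.homEquiv (𝟙 P)

/-- The universal measuring `P ⊗ B ⟶ A`, the transpose of the universal morphism
`B ⟶ [P, A]`. -/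
def UniversalMeasuring.eval {P : Comon V} {B A : V} [MonObj B] [MonObj A]
    (h : UniversalMeasuring P B A) : P.X ⊗ B ⟶ A :=
  uncurry (A := P.X) (X := A) (Y := B) (UniversalMeasuring.unit h).hom

/-- `S` is the canonical bimonoid structure on `P = P(B, A)`, where `B` is a bimonoid: its
comonoid structure is the given one of `P`, its multiplication satisfies
`(p * q)(b) = ∑ p (b₁) * q (b₂)` and its unit satisfies `1 (b) = ε (b) • 1`, where the measuring
`P ⊗ B ⟶ A` is written `p ⊗ b ↦ p (b)`. -/
structure IsCanonical {P : Comon V} {B A : V} [BimonObj B] [MonObj A]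
    (h : UniversalMeasuring P B A) (S : BimonObj P.X) : Prop where
  comon_eq : S.toComonObj = P.comon
  mul_eval : S.mul ▷ B ≫ UniversalMeasuring.eval h =
    (P.X ⊗ P.X) ◁ Δ[B] ≫ tensorμ P.X P.X B B ≫
      (UniversalMeasuring.eval h ⊗ₘ UniversalMeasuring.eval h) ≫ μ[A]
  one_eval : S.one ▷ B ≫ UniversalMeasuring.eval h = (λ_ B).hom ≫ ε[B] ≫ η[A]

/-- The monoid underlying the bimonoid structure `S` is commutative. -/
def IsCommBimon {X : V} (S : BimonObj X) : Prop :=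
  letI := S.toMonObj
  IsCommMonObj X

end

end Sweedler

/-! By transposition, a monoid morphism `B ⟶ [C, A]` is a measuring `C ⊗ B ⟶ A`, so `P(B, A)`
represents the presheaf of measurings on comonoids. Colimits of comonoids are computed in `V` and
preserved by tensoring, hence this presheaf turns colimits into limits
(`preservesLimits_convFunctor_coyoneda`). Such a presheaf is representable once comonoids have a
small dense subcategory (`isRepresentable_of_isDense`).

For `κ` regular and uncountable with `V` locally `κ`-presentable, the comonoids with `κ`-presentable
carrier are dense (`isDense_comonProperty`). The crux is `exists_presentable_comon`: write the
carrier of `C` as a `κ`-filtered colimit of presentable objects and lift its comultiplication stage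
by stage, each comonoid axiom becoming true one stage later. The colimit of the resulting sequence
is a comonoid, presentable because `κ` is uncountable. Tensor products of presentable objects need
not be presentable; only maps out of presentable objects are lifted.

For the bimonoid structure, `Δ[B]` is a monoid morphism, and so is `μ[A]` when `A` is commutative;
hence the pointwise product of two measurings is a measuring. The multiplication and unit of `P`
classify the pointwise square of the evaluation and the constant measuring. The monoid axioms,
commutativity and uniqueness compare comonoid morphisms into `P`, so they can be tested after
evaluation, where they reduce to properties of `B` and `A`. -/

namespace Sweedler

open Limits Opposite

/-! ### Colimits of comonoids, obtained from limits of monoids in `Vᵒᵖ`. -/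

section ComonoidColimits

variable {V : Type u} [Category.{v} V] [MonoidalCategory V]

instance hasColimitsOfSize_comon [HasColimitsOfSize.{v, v} V] :
    HasColimitsOfSize.{v, v} (Comon V) where
  has_colimits_of_shape J _ := by
    have : HasLimitsOfShape Jᵒᵖ (Mon Vᵒᵖ) := inferInstance
    have : HasColimitsOfShape J (Mon Vᵒᵖ)ᵒᵖ := inferInstance
    exact Adjunction.hasColimitsOfShape_of_equivalence (Comon.Comon_EquivMon_OpOp V).functor

instance preservesColimitsOfSize_forget_comon [HasColimitsOfSize.{v, v} V] :
    PreservesColimitsOfSize.{v, v} (Comon.forget V) := by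
  let F : Comon V ⥤ Vᵒᵖᵒᵖ := (Comon.Comon_EquivMon_OpOp V).functor ⋙ (Mon.forget Vᵒᵖ).op
  have : PreservesColimitsOfSize.{v, v} (Mon.forget Vᵒᵖ).op := by
    have : PreservesLimitsOfSize.{v, v} (Mon.forget Vᵒᵖ) := ⟨inferInstance⟩
    exact preservesColimitsOfSize_op _
  have : PreservesColimitsOfSize.{v, v} (F ⋙ unopUnop V) := inferInstance
  exact preservesColimits_of_natIso (show F ⋙ unopUnop V ≅ Comon.forget V from Iso.refl _)

/-- The comonoids whose underlying object satisfies `Q`. -/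
abbrev comonProperty (Q : ObjectProperty V) : ObjectProperty (Comon V) :=
  Q.inverseImage (Comon.forget V)

/-- Transport of a comonoid structure along an isomorphism. -/
abbrev comonObjOfIso {X Y : V} [ComonObj X] (e : X ≅ Y) : ComonObj Y where
  counit := e.inv ≫ ε[X]
  comul := e.inv ≫ Δ[X] ≫ (e.hom ⊗ₘ e.hom)
  counit_comul := by
    simp [← tensorHom_id]
  comul_counit := by
    simp [← id_tensorHom]
  comul_assoc := by
    simpa [← id_tensorHom, ← tensorHom_id, -associator_conjugation, -ComonObj.comul_assoc,
      ← associator_naturality] using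
      congr(e.inv ≫ $(ComonObj.comul_assoc X) ≫ (e.hom ⊗ₘ e.hom ⊗ₘ e.hom))

/-- A fixed object carries only a `v`-small set of comonoid structures, and these transport along
isomorphisms to a small set of representatives. -/
instance essentiallySmall_comonProperty (Q : ObjectProperty V)
    [ObjectProperty.EssentiallySmall.{v} Q] :
    ObjectProperty.EssentiallySmall.{v} (comonProperty Q) := by
  obtain ⟨Q', _, hQ', h⟩ := ObjectProperty.EssentiallySmall.exists_small_le Q
  let f : (Σ X : Subtype Q', ComonObj X.1) → Comon V := fun x ↦ @Comon.mk V _ _ x.1.1 x.2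
  have : Small.{v} (Subtype Q') := inferInstance
  refine ⟨ObjectProperty.ofObj f, ?_, ?_⟩
  · infer_instance
  · rintro C hC
    obtain ⟨Y, hY, ⟨e⟩⟩ := h _ hC
    let _ := comonObjOfIso (X := C.X) e
    refine ⟨f ⟨⟨Y, hY⟩, inferInstance⟩, ObjectProperty.ofObj_apply _ _, ⟨Comon.mkIso ?_ ?_ ?_⟩⟩
    · exact e
    · exact e.hom_inv_id_assoc _
    · exact e.hom_inv_id_assoc _

end ComonoidColimits

/-! ### Tensor products of filtered colimits. -/

section TensorCocone

variable {V : Type u} [Category.{v} V] [MonoidalCategory V]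
  {J : Type v} [SmallCategory J] {Y Z : J ⥤ V}

/-- The tensor product of two cocones over diagrams of the same shape. -/
@[simps!]
def tensorCocone (c : Cocone Y) (d : Cocone Z) : Cocone (Y ⊗ Z) :=
  ⟨c.pt ⊗ d.pt,
    { app := fun j ↦ c.ι.app j ⊗ₘ d.ι.app j
      naturality := fun i j f ↦ by simp }⟩

variable [SymmetricCategory V] [MonoidalClosed V]

/-- In a symmetric monoidal closed category, the tensor product of two filtered colimit cocones
of the same shape is a colimit cocone. -/
noncomputable def isColimitTensorCocone [IsFiltered J] {c : Cocone Y} {d : Cocone Z}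
    (hc : IsColimit c) (hd : IsColimit d) : IsColimit (tensorCocone c d) := by
  -- The tensor product preserves colimits in each variable, which gives a colimit over `J × J`; the
  -- diagonal of the filtered `J` is final in it.
  have h1 (X : V) : PreservesColimit Y ((curriedTensor V).flip.obj X) :=
    preservesColimit_of_natIso _ (show tensorLeft X ≅ (curriedTensor V).flip.obj X from
      NatIso.ofComponents (fun Z ↦ β_ X Z))
  have h2 (X : V) : PreservesColimit Z ((curriedTensor V).obj X) :=
    inferInstanceAs (PreservesColimit Z (tensorLeft X))
  let h := isColimitOfPreserves₂ (curriedTensor V) hc hd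
  let e : Functor.diag J ⋙ Functor.uncurry.obj
      (((Functor.whiskeringLeft₂ V).obj Y).obj Z |>.obj (curriedTensor V)) ≅ Y ⊗ Z :=
    NatIso.ofComponents (fun j ↦ Iso.refl _) fun f ↦ by simp [MonoidalCategory.tensorHom_def]
  refine IsColimit.equivOfNatIsoOfIso e _ (tensorCocone c d) (Cocone.ext (Iso.refl _) fun j ↦ ?_)
    ((Functor.Final.isColimitWhiskerEquiv (Functor.diag J) _).symm h)
  exact (Category.comp_id _).trans ((Category.id_comp _).trans
    (MonoidalCategory.tensorHom_def _ _).symm)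

end TensorCocone

/-! ### Lifting a comultiplication one stage along a filtered colimit. -/

section Step

variable {V : Type u} [Category.{v} V] [MonoidalCategory V]
  {J : Type v} [SmallCategory J] {Y : J ⥤ V} (κ : Cardinal.{v}) [Fact κ.IsRegular]

/-- A partial comultiplication: for a comonoid `c.pt` which is presented as a colimit of `Y`, an
object `X` over `c.pt` together with a lift of its comultiplication to a stage of the diagram. -/
structure PartialComul (c : Cocone Y) [ComonObj c.pt] where
  /-- the object on which the comultiplication is defined -/
  X : V
  presentable : IsCardinalPresentable X κ
  /-- the stage at which the comultiplication takes its values -/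
  i : J
  /-- the transition map -/
  f : X ⟶ Y.obj i
  /-- the comultiplication -/
  δ : X ⟶ Y.obj i ⊗ Y.obj i
  comm : δ ≫ (c.ι.app i ⊗ₘ c.ι.app i) = f ≫ c.ι.app i ≫ Δ[c.pt]

/-- The comonoid axioms up to the next stage, for a partial comultiplication `S` and a partial
comultiplication `δ` on the target of `S`. -/
structure PartialComul.IsNext {c : Cocone Y} [ComonObj c.pt] (S : PartialComul κ c) {j : J}
    (f : Y.obj S.i ⟶ Y.obj j) (δ : Y.obj S.i ⟶ Y.obj j ⊗ Y.obj j) : Prop where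
  comm : δ ≫ (c.ι.app j ⊗ₘ c.ι.app j) = f ≫ c.ι.app j ≫ Δ[c.pt]
  comp_app : f ≫ c.ι.app j = c.ι.app S.i
  natural : S.δ ≫ (f ⊗ₘ f) = S.f ≫ δ
  coassoc : S.δ ≫ (δ ⊗ₘ f) ≫ (α_ _ _ _).hom = S.δ ≫ (f ⊗ₘ δ)
  counit_left : S.δ ≫ ((c.ι.app S.i ≫ ε[c.pt]) ⊗ₘ f) = S.f ≫ f ≫ (λ_ _).inv
  counit_right : S.δ ≫ (f ⊗ₘ (c.ι.app S.i ≫ ε[c.pt])) = S.f ≫ f ≫ (ρ_ _).inv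

lemma map_eq_comp {V : Type u} [Category.{v} V] {F : J ⥤ V} {X : V} {l m n : J}
    {f g : X ⟶ F.obj l} {a : l ⟶ m}
    (h : f ≫ F.map a = g ≫ F.map a) (b : m ⟶ n) {w : l ⟶ n} (hw : a ≫ b = w) :
    f ≫ F.map w = g ≫ F.map w := by
  subst hw
  simp only [Functor.map_comp, reassoc_of% h]

section

variable {A B C D : V} [ComonObj C] (δ : A ⟶ B ⊗ B) (f : A ⟶ B) {b : B ⟶ C}
  (h : δ ≫ (b ⊗ₘ b) = f ≫ b ≫ Δ[C])

include h

/-- Over `C` both sides become the twofold comultiplication applied to `f ≫ b`. -/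
lemma coassoc_of_lift (δ' : B ⟶ D ⊗ D) (f' : B ⟶ D) {d : D ⟶ C} (hf' : f' ≫ d = b)
    (h' : δ' ≫ (d ⊗ₘ d) = b ≫ Δ[C]) :
    (δ ≫ (δ' ⊗ₘ f') ≫ (α_ _ _ _).hom) ≫ (d ⊗ₘ (d ⊗ₘ d)) =
      (δ ≫ (f' ⊗ₘ δ')) ≫ (d ⊗ₘ (d ⊗ₘ d)) := by
  have e₁ : (b ≫ Δ[C] ⊗ₘ b) = (b ⊗ₘ b) ≫ Δ[C] ▷ C := by
    rw [← tensorHom_id, tensorHom_comp_tensorHom, Category.comp_id]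
  have e₂ : (b ⊗ₘ b ≫ Δ[C]) = (b ⊗ₘ b) ≫ C ◁ Δ[C] := by
    rw [← id_tensorHom, tensorHom_comp_tensorHom, Category.comp_id]
  simp only [Category.assoc, ← associator_naturality, tensorHom_comp_tensorHom_assoc,
    tensorHom_comp_tensorHom, h', hf', e₁, e₂, reassoc_of% h, ComonObj.comul_assoc]

lemma counit_left_of_lift : δ ≫ ((b ≫ ε[C]) ⊗ₘ b) ≫ (λ_ _).hom = f ≫ b := by
  have e₁ : (b ≫ ε[C] ⊗ₘ b) = (b ⊗ₘ b) ≫ ε[C] ▷ C := by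
    rw [← tensorHom_id, tensorHom_comp_tensorHom, Category.comp_id]
  simp [e₁, reassoc_of% h]

lemma counit_right_of_lift : δ ≫ (b ⊗ₘ (b ≫ ε[C])) ≫ (ρ_ _).hom = f ≫ b := by
  have e₁ : (b ⊗ₘ b ≫ ε[C]) = (b ⊗ₘ b) ≫ C ◁ ε[C] := by
    rw [← id_tensorHom, tensorHom_comp_tensorHom, Category.comp_id]
  simp [e₁, reassoc_of% h]

end

variable [SymmetricCategory V] [MonoidalClosed V] [IsCardinalFiltered J κ]

/-- Presentability of `Y.obj S.i` lifts the comultiplication to some stage. The axioms are equations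
between maps out of the presentable `S.X` that hold in the colimit, so each already holds at a later
stage. -/
lemma PartialComul.exists_isNext {c : Cocone Y} [ComonObj c.pt] (hc : IsColimit c)
    (hY : ∀ j, IsCardinalPresentable (Y.obj j) κ) (S : PartialComul κ c) :
    ∃ (j : J) (f : Y.obj S.i ⟶ Y.obj j) (δ : Y.obj S.i ⟶ Y.obj j ⊗ Y.obj j),
      S.IsNext κ f δ := by
  have := isFiltered_of_isCardinalFiltered J κ
  have := S.presentable
  have hS := S.comm
  have hc2 := isColimitTensorCocone hc hc
  have hc3 := isColimitTensorCocone hc hc2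
  obtain ⟨k, δk, hδk : δk ≫ (c.ι.app k ⊗ₘ c.ι.app k) = c.ι.app S.i ≫ Δ[c.pt]⟩ :=
    IsCardinalPresentable.exists_hom_of_isColimit κ hc2 (c.ι.app S.i ≫ Δ[c.pt])
  obtain ⟨l, a, b, -⟩ := IsFilteredOrEmpty.cocone_objs S.i k
  obtain ⟨f, hf⟩ : ∃ f : Y.obj S.i ⟶ Y.obj l, f ≫ c.ι.app l = c.ι.app S.i :=
    ⟨Y.map a, by simp⟩
  obtain ⟨δ, hδ⟩ : ∃ δ : Y.obj S.i ⟶ Y.obj l ⊗ Y.obj l,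
      δ ≫ (c.ι.app l ⊗ₘ c.ι.app l) = c.ι.app S.i ≫ Δ[c.pt] :=
    ⟨(show Y.obj S.i ⟶ Y.obj k ⊗ Y.obj k from δk) ≫ (Y.map b ⊗ₘ Y.map b), by
      rw [Category.assoc, tensorHom_comp_tensorHom, c.w]
      exact hδk⟩
  obtain ⟨l₁, u₁, h₁⟩ := IsCardinalPresentable.exists_eq_of_isColimit' κ hc2
    (i := l) (S.δ ≫ (f ⊗ₘ f)) (S.f ≫ δ) (by
      change (S.δ ≫ (f ⊗ₘ f)) ≫ (c.ι.app l ⊗ₘ c.ι.app l) =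
        (S.f ≫ δ) ≫ (c.ι.app l ⊗ₘ c.ι.app l)
      simp [hf, hδ, hS])
  obtain ⟨l₂, u₂, h₂⟩ := IsCardinalPresentable.exists_eq_of_isColimit' κ hc3
    (i := l) (S.δ ≫ (δ ⊗ₘ f) ≫ (α_ _ _ _).hom) (S.δ ≫ (f ⊗ₘ δ))
    (coassoc_of_lift (C := c.pt) _ _ hS _ _ hf hδ)
  obtain ⟨l₃, u₃, h₃⟩ := IsCardinalPresentable.exists_eq_of_isColimit' κ hc
    (i := l) (S.δ ≫ ((c.ι.app S.i ≫ (ε[c.pt] : c.pt ⟶ 𝟙_ V)) ⊗ₘ f) ≫ (λ_ _).hom) (S.f ≫ f) (by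
      have := counit_left_of_lift (C := c.pt) S.δ S.f hS
      simp only [Category.assoc, ← leftUnitor_naturality, ← id_tensorHom,
        tensorHom_comp_tensorHom_assoc, Category.comp_id, hf]
      exact this)
  obtain ⟨l₄, u₄, h₄⟩ := IsCardinalPresentable.exists_eq_of_isColimit' κ hc
    (i := l) (S.δ ≫ (f ⊗ₘ (c.ι.app S.i ≫ (ε[c.pt] : c.pt ⟶ 𝟙_ V))) ≫ (ρ_ _).hom) (S.f ≫ f) (by
      have := counit_right_of_lift (C := c.pt) S.δ S.f hS
      simp only [Category.assoc, ← rightUnitor_naturality, ← tensorHom_id,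
        tensorHom_comp_tensorHom_assoc, Category.comp_id, hf]
      exact this)
  -- The four equations hold at four different stages after `l`; they are moved to a common stage
  -- `p` along a single map `w`.
  obtain ⟨m, a₁, a₂, ha⟩ := IsFiltered.span u₁ u₂
  obtain ⟨n, b₃, b₄, hb⟩ := IsFiltered.span u₃ u₄
  obtain ⟨p, a, b, hab⟩ := IsFiltered.span (u₁ ≫ a₁) (u₃ ≫ b₃)
  obtain ⟨w, hw⟩ : ∃ w : l ⟶ p, w = u₁ ≫ a₁ ≫ a := ⟨_, rfl⟩
  replace h₁ : (S.δ ≫ (f ⊗ₘ f)) ≫ (Y.map w ⊗ₘ Y.map w) = (S.f ≫ δ) ≫ (Y.map w ⊗ₘ Y.map w) :=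
    map_eq_comp (F := Y ⊗ Y) h₁ (a₁ ≫ a) (by simp [hw])
  replace h₂ : (S.δ ≫ (δ ⊗ₘ f) ≫ (α_ _ _ _).hom) ≫ (Y.map w ⊗ₘ (Y.map w ⊗ₘ Y.map w)) =
      (S.δ ≫ (f ⊗ₘ δ)) ≫ (Y.map w ⊗ₘ (Y.map w ⊗ₘ Y.map w)) :=
    map_eq_comp (F := Y ⊗ (Y ⊗ Y)) h₂ (a₂ ≫ a) (by simp [hw, reassoc_of% ha])
  replace h₃ := map_eq_comp h₃ (b₃ ≫ b) (w := w) (by simpa [hw] using hab.symm)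
  replace h₄ := map_eq_comp h₄ (b₄ ≫ b) (w := w) (by
    simpa [hw, reassoc_of% hb] using hab.symm)
  refine ⟨p, f ≫ Y.map w, δ ≫ (Y.map w ⊗ₘ Y.map w), ?_, ?_, ?_, ?_, ?_, ?_⟩
  · simp [hδ, reassoc_of% hf]
  · simp [hf]
  · simpa using h₁
  · simp only [Category.assoc, ← associator_naturality, tensorHom_comp_tensorHom,
      tensorHom_comp_tensorHom_assoc] at h₂
    exact h₂
  · rw [← cancel_mono (λ_ _).hom]
    simp only [Category.assoc, ← leftUnitor_naturality, ← id_tensorHom,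
      tensorHom_comp_tensorHom_assoc, Category.comp_id, Iso.inv_hom_id] at h₃ ⊢
    exact h₃
  · rw [← cancel_mono (ρ_ _).hom]
    simp only [Category.assoc, ← rightUnitor_naturality, ← tensorHom_id,
      tensorHom_comp_tensorHom_assoc, Category.comp_id, Iso.inv_hom_id] at h₄ ⊢
    exact h₄

end Step

/-! ### Comonoid structures on colimits of sequences. -/

section Sequence

variable {V : Type u} [Category.{v} V]

/-- The universal property of a colimit of a sequence of morphisms. -/
structure IsSequentialColimit {X : ℕ → V} (f : ∀ n, X n ⟶ X (n + 1)) {W : V}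
    (i : ∀ n, X n ⟶ W) : Prop where
  w (n : ℕ) : f n ≫ i (n + 1) = i n
  exists_desc {T : V} (g : ∀ n, X n ⟶ T) (hg : ∀ n, f n ≫ g (n + 1) = g n) :
    ∃ h : W ⟶ T, ∀ n, i n ≫ h = g n
  hom_ext {T : V} {g h : W ⟶ T} (hgh : ∀ n, i n ≫ g = i n ≫ h) : g = h

lemma isSequentialColimit {X : ℕ → V} (f : ∀ n, X n ⟶ X (n + 1))
    {c : Cocone (Functor.ofSequence f)} (hc : IsColimit c) :
    IsSequentialColimit f (fun n ↦ c.ι.app n) where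
  w n := by
    rw [← c.w (homOfLE (Nat.le_add_right n 1)), Functor.ofSequence_map_homOfLE_succ]
    rfl
  exists_desc {T} g hg := by
    let s : Cocone (Functor.ofSequence f) :=
      ⟨T, NatTrans.ofSequence g fun n ↦ by
        rw [Functor.ofSequence_map_homOfLE_succ]
        exact (hg n).trans (Category.comp_id _).symm⟩
    exact ⟨hc.desc s, fun n ↦ hc.fac s n⟩
  hom_ext := hc.hom_ext

variable [MonoidalCategory V]

/-- A sequence of partial comultiplications which satisfies the comonoid axioms up to a shift
induces a comonoid structure on the colimit. -/
lemma IsSequentialColimit.exists_comonObj {X : ℕ → V} {f : ∀ n, X n ⟶ X (n + 1)} {W : V}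
    {i : ∀ n, X n ⟶ W} (hi : IsSequentialColimit f i)
    (δ : ∀ n, X n ⟶ X (n + 1) ⊗ X (n + 1)) (e : ∀ n, X n ⟶ 𝟙_ V)
    (he : ∀ n, f n ≫ e (n + 1) = e n)
    (natural : ∀ n, δ n ≫ (f (n + 1) ⊗ₘ f (n + 1)) = f n ≫ δ (n + 1))
    (coassoc : ∀ n, δ n ≫ (δ (n + 1) ⊗ₘ f (n + 1)) ≫ (α_ _ _ _).hom =
      δ n ≫ (f (n + 1) ⊗ₘ δ (n + 1)))
    (counit_left : ∀ n, δ n ≫ (e (n + 1) ⊗ₘ f (n + 1)) = f n ≫ f (n + 1) ≫ (λ_ _).inv)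
    (counit_right : ∀ n, δ n ≫ (f (n + 1) ⊗ₘ e (n + 1)) = f n ≫ f (n + 1) ≫ (ρ_ _).inv) :
    ∃ _ : ComonObj W, (∀ n, i n ≫ Δ[W] = δ n ≫ (i (n + 1) ⊗ₘ i (n + 1))) ∧
      ∀ n, i n ≫ ε[W] = e n := by
  obtain ⟨comul, hΔ⟩ := hi.exists_desc (fun n ↦ δ n ≫ (i (n + 1) ⊗ₘ i (n + 1))) fun n ↦ by
    rw [← reassoc_of% (natural n), tensorHom_comp_tensorHom, hi.w]
  obtain ⟨counit, hε⟩ := hi.exists_desc e he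
  refine ⟨⟨counit, comul, ?_, ?_, ?_⟩, hΔ, hε⟩
  · refine hi.hom_ext fun n ↦ ?_
    -- The counit law is available only after a transition map, so `i (n + 1)` is factored through
    -- stage `n + 2`.
    have h : (e (n + 1) ⊗ₘ i (n + 1)) = (e (n + 1) ⊗ₘ f (n + 1)) ≫ 𝟙_ V ◁ i (n + 2) := by
      rw [← id_tensorHom, tensorHom_comp_tensorHom, hi.w, Category.comp_id]
    rw [reassoc_of% (hΔ n), ← tensorHom_id, tensorHom_comp_tensorHom, hε, Category.comp_id, h,
      reassoc_of% (counit_left n), ← leftUnitor_inv_naturality, reassoc_of% (hi.w (n + 1)),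
      reassoc_of% (hi.w n)]
  · refine hi.hom_ext fun n ↦ ?_
    have h : (i (n + 1) ⊗ₘ e (n + 1)) = (f (n + 1) ⊗ₘ e (n + 1)) ≫ i (n + 2) ▷ 𝟙_ V := by
      rw [← tensorHom_id, tensorHom_comp_tensorHom, hi.w, Category.comp_id]
    rw [reassoc_of% (hΔ n), ← id_tensorHom, tensorHom_comp_tensorHom, hε, Category.comp_id, h,
      reassoc_of% (counit_right n), ← rightUnitor_inv_naturality, reassoc_of% (hi.w (n + 1)),
      reassoc_of% (hi.w n)]
  · refine hi.hom_ext fun n ↦ ?_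
    rw [reassoc_of% (hΔ n), reassoc_of% (hΔ n), ← tensorHom_id, ← id_tensorHom,
      tensorHom_comp_tensorHom, tensorHom_comp_tensorHom_assoc, hΔ, Category.comp_id,
      ← hi.w (n + 1), ← tensorHom_comp_tensorHom, ← reassoc_of% (coassoc n),
      ← tensorHom_comp_tensorHom_assoc, associator_naturality]

end Sequence

/-! ### Enlarging presentable objects over a comonoid to presentable comonoids. -/

section Enlarge

variable {V : Type u} [Category.{v} V] [MonoidalCategory V] [SymmetricCategory V]
  [MonoidalClosed V]

lemma hasCardinalLT_arrow_nat {κ : Cardinal.{v}} (hκ : Cardinal.aleph0 < κ) :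
    HasCardinalLT (Arrow ℕ) κ := by
  have : Function.Injective fun a : Arrow ℕ ↦ (a.left, a.right) := by
    rintro ⟨a, b, f⟩ ⟨a', b', f'⟩ h
    obtain ⟨h₁ : a = a', h₂ : b = b'⟩ := Prod.mk.inj h
    subst h₁ h₂
    obtain rfl : f = f' := Subsingleton.elim _ _
    rfl
  have := this.countable
  exact (Cardinal.lift_le_aleph0.2 Cardinal.mk_le_aleph0).trans_lt (Cardinal.aleph0_lt_lift.2 hκ)

/-- Let `D ⟶ C` be a morphism of comonoids, with `D` presentable. Any factorization of the
underlying morphism through a presentable object `Q` can be enlarged to a factorization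
through a presentable comonoid. -/
lemma exists_presentable_comon {κ : Cardinal.{v}} [Fact κ.IsRegular] (hκ : Cardinal.aleph0 < κ)
    [IsCardinalLocallyPresentable V κ] {C D : Comon V} (g : D ⟶ C)
    (hD : IsCardinalPresentable D.X κ) {Q : V} (hQ : IsCardinalPresentable Q κ)
    (q : D.X ⟶ Q) (r : Q ⟶ C.X) (hqr : q ≫ r = g.hom) :
    ∃ (D' : Comon V) (_ : IsCardinalPresentable D'.X κ) (g' : D' ⟶ C) (s : Q ⟶ D'.X)
      (t : D ⟶ D'), s ≫ g'.hom = r ∧ q ≫ s = t.hom := by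
  obtain ⟨J, _, _, ⟨p⟩⟩ :=
    (isCardinalFilteredGenerator_isCardinalPresentable V κ).exists_colimitsOfShape C.X
  let c : Cocone p.diag := Cocone.mk _ p.ι
  let _ : ComonObj c.pt := C.comon
  have hc : IsColimit c := p.isColimit
  have hY := p.prop_diag_obj
  obtain ⟨i₀, r', hr⟩ := IsCardinalPresentable.exists_hom_of_isColimit κ hc r
  -- The sequence starts with `D.X` itself, its comultiplication pushed forward along `q ≫ r'`; this
  -- makes `D` map to the colimit by a comonoid morphism.
  let S₀ : PartialComul κ c :=
    { X := D.X
      presentable := hD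
      i := i₀
      f := q ≫ r'
      δ := Δ[D.X] ≫ (q ≫ r' ⊗ₘ q ≫ r')
      comm := by
        have : (q ≫ r') ≫ c.ι.app i₀ = g.hom := by rw [Category.assoc, hr, hqr]
        rw [Category.assoc, tensorHom_comp_tensorHom, ← Category.assoc _ _ Δ[c.pt], this]
        exact (IsComonHom.hom_comul g.hom).symm }
  choose j f δ h using fun S : PartialComul κ c ↦ S.exists_isNext κ hc hY
  let next (S : PartialComul κ c) : PartialComul κ c :=
    { X := p.diag.obj S.i
      presentable := hY _
      i := j S
      f := f S
      δ := δ S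
      comm := (h S).comm }
  let S : ℕ → PartialComul κ c := fun n ↦ n.rec S₀ fun _ ↦ next
  let X : ℕ → V := fun n ↦ (S n).X
  let φ : ∀ n, X n ⟶ X (n + 1) := fun n ↦ (S n).f
  let x : ∀ n, X n ⟶ C.X := fun n ↦ (S n).f ≫ c.ι.app (S n).i
  have hφ (n) : φ n ≫ x (n + 1) = x n := congr((S n).f ≫ $((h (S n)).comp_app))
  have hx (n) : x (n + 1) = c.ι.app (S n).i := (h (S n)).comp_app
  obtain ⟨W, hW, i, hi⟩ : ∃ (W : V) (_ : IsCardinalPresentable W κ) (i : ∀ n, X n ⟶ W),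
      IsSequentialColimit φ i := by
    refine ⟨_, ?_, _, isSequentialColimit φ (colimit.isColimit (Functor.ofSequence φ))⟩
    have (n : ℕ) : IsCardinalPresentable ((Functor.ofSequence φ).obj n) κ := (S n).presentable
    -- Uncountability of `κ` enters here: a countable colimit of presentable objects is presentable.
    refine isCardinalPresentable_of_isColimit _ (colimit.isColimit _) κ (hasCardinalLT_arrow_nat hκ)
  obtain ⟨_, hΔ, hε⟩ := hi.exists_comonObj (fun n ↦ (S n).δ) (fun n ↦ x n ≫ ε[C.X])
    (fun n ↦ by rw [reassoc_of% (hφ n)]) (fun n ↦ (h (S n)).natural)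
    (fun n ↦ (h (S n)).coassoc) (fun n ↦ by rw [hx]; exact (h (S n)).counit_left)
    (fun n ↦ by rw [hx]; exact (h (S n)).counit_right)
  obtain ⟨g', hg'⟩ := hi.exists_desc x hφ
  -- The transition map out of stage `0` is `q ≫ r'`, so `Q` enters the colimit at stage `1`.
  have h₀ : q ≫ r' ≫ i 1 = i 0 := (Category.assoc _ _ _).symm.trans (hi.w 0)
  refine ⟨⟨W⟩, hW, Comon.Hom.mk' g' ?_ ?_, r' ≫ i 1, Comon.Hom.mk' (i 0) ?_ ?_, ?_, h₀⟩
  · refine hi.hom_ext fun n ↦ ?_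
    rw [reassoc_of% (hg' n), hε]
  · refine hi.hom_ext fun n ↦ ?_
    rw [reassoc_of% (hg' n), reassoc_of% (hΔ n), tensorHom_comp_tensorHom, hg', hx]
    exact (Category.assoc _ _ _).trans (S n).comm.symm
  · rw [hε]
    have : x 0 = g.hom := (Category.assoc _ _ _).trans (congr(q ≫ $hr).trans hqr)
    rw [this]
    exact IsComonHom.hom_counit g.hom
  · rw [hΔ, ← hi.w 0, ← tensorHom_comp_tensorHom]
    exact Category.assoc _ _ _
  · rw [Category.assoc, hg']
    exact congr(r' ≫ $(hx 0)).trans hr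

end Enlarge

/-! ### Density of the comonoids with presentable carrier. -/

section Dense

variable {V : Type u} [Category.{v} V] [MonoidalCategory V] (κ : Cardinal.{v}) [Fact κ.IsRegular]

lemma isClosedUnderColimitsOfShape_comonProperty [HasColimitsOfSize.{v, v} V]
    {A : Type*} [Category* A] [HasLimitsOfShape Aᵒᵖ (Type v)]
    [PreservesColimitsOfShape A (Comon.forget V)] (hA : HasCardinalLT (Arrow A) κ) :
    (comonProperty (isCardinalPresentable V κ)).IsClosedUnderColimitsOfShape A where
  colimitsOfShape_le := by
    rintro X ⟨hX⟩
    have (a : A) : IsCardinalPresentable ((hX.diag ⋙ Comon.forget V).obj a) κ :=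
      hX.prop_diag_obj a
    exact isCardinalPresentable_of_isColimit _
      (isColimitOfPreserves (Comon.forget V) hX.isColimit) κ hA

/-- Presentable comonoids are closed under `κ`-small colimits, so a `κ`-small diagram over `C` has
its colimit as a cocone. -/
instance isCardinalFiltered_costructuredArrow_comonProperty [HasColimitsOfSize.{v, v} V]
    (C : Comon V) :
    IsCardinalFiltered
      (CostructuredArrow (comonProperty (isCardinalPresentable V κ)).ι C) κ where
  nonempty_cocone {A _} F hA := by
    have := isClosedUnderColimitsOfShape_comonProperty (V := V) κ hA
    have : HasColimit F := inferInstance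
    exact ⟨colimit.cocone F⟩

variable {κ} [SymmetricCategory V] [MonoidalClosed V]

/-- In a locally `κ`-presentable symmetric monoidal closed category with `κ` uncountable, the
comonoids whose underlying object is `κ`-presentable are dense among all comonoids. -/
lemma isDense_comonProperty (hκ : Cardinal.aleph0 < κ) [IsCardinalLocallyPresentable V κ] :
    (comonProperty (isCardinalPresentable V κ)).ι.IsDense where
  isDenseAt C := by
    let P := comonProperty (isCardinalPresentable V κ)
    let E := Functor.LeftExtension.mk _ P.ι.rightUnitor.inv
    let Φ := CostructuredArrow.proj P.ι C ⋙ P.ι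
    have : EssentiallySmall.{v} (CostructuredArrow P.ι C) := inferInstance
    have := isFiltered_of_isCardinalFiltered (CostructuredArrow P.ι C) κ
    have : HasColimitsOfShape (CostructuredArrow P.ι C) (Comon V) :=
      hasColimitsOfShape_of_equivalence (equivSmallModel.{v} (CostructuredArrow P.ι C)).symm
    have : PreservesColimitsOfShape (CostructuredArrow P.ι C) (Comon.forget V) :=
      preservesColimitsOfShape_of_equiv (equivSmallModel.{v} (CostructuredArrow P.ι C)).symm _
    let φ : colimit Φ ⟶ C := colimit.desc Φ (E.coconeAt C)
    have hφ (k : CostructuredArrow P.ι C) : colimit.ι Φ k ≫ φ = k.hom :=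
      (colimit.ι_desc _ _).trans (Category.id_comp _)
    have hT := isColimitOfPreserves (Comon.forget V) (colimit.isColimit Φ)
    have hV := (isCardinalFilteredGenerator_isCardinalPresentable V κ).isStrongGenerator
    -- Two maps from a presentable `G` that agree in `C` factor through one stage `j`. Their
    -- coequalizer lies over `C`, and enlarging it to a comonoid gives a later stage where they
    -- agree.
    have : Mono φ.hom := by
      rw [hV.isSeparating.mono_iff]
      intro G hG g₁ g₂ h
      have : IsCardinalPresentable G κ := hG
      obtain ⟨j₁, f₁, hf₁⟩ := IsCardinalPresentable.exists_hom_of_isColimit κ hT g₁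
      obtain ⟨j₂, f₂, hf₂⟩ := IsCardinalPresentable.exists_hom_of_isColimit κ hT g₂
      obtain ⟨j, f₁, f₂, rfl, rfl⟩ : ∃ (j : CostructuredArrow P.ι C) (f₁ f₂ : G ⟶ (Φ.obj j).X),
          f₁ ≫ (colimit.ι Φ j).hom = g₁ ∧ f₂ ≫ (colimit.ι Φ j).hom = g₂ := by
        refine ⟨IsFiltered.max j₁ j₂, f₁ ≫ (Φ.map (IsFiltered.leftToMax j₁ j₂)).hom,
          f₂ ≫ (Φ.map (IsFiltered.rightToMax j₁ j₂)).hom, ?_, ?_⟩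
        · exact (Category.assoc _ _ _).trans (congr(f₁ ≫ Comon.Hom.hom $(colimit.w Φ _)).trans hf₁)
        · exact (Category.assoc _ _ _).trans (congr(f₂ ≫ Comon.Hom.hom $(colimit.w Φ _)).trans hf₂)
      simp only [Category.assoc, ← Comon.comp_hom', hφ] at h
      have hQ : IsCardinalPresentable (coequalizer f₁ f₂) κ := by
        have : ∀ k, IsCardinalPresentable ((parallelPair f₁ f₂).obj k) κ := by
          rintro (_ | _)
          · exact hG
          · exact j.left.property
        refine isCardinalPresentable_of_isColimit _ (colimit.isColimit (parallelPair f₁ f₂)) κ ?_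
        refine .of_le ?_ (Cardinal.IsRegular.aleph0_le Fact.out)
        simp only [hasCardinalLT_aleph0_iff]
        infer_instance
      obtain ⟨D', hD', g', s, t, hs, ht⟩ := exists_presentable_comon hκ j.hom j.left.property hQ
        (coequalizer.π f₁ f₂) (coequalizer.desc _ h) (coequalizer.π_desc _ _)
      have htg : t ≫ g' = j.hom := Comon.Hom.ext <|
        congr($ht.symm ≫ g'.hom).trans <| (Category.assoc _ _ _).trans <|
          congr(coequalizer.π f₁ f₂ ≫ $hs).trans (coequalizer.π_desc _ _)
      let k : CostructuredArrow P.ι C :=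
        CostructuredArrow.mk (S := P.ι) (Y := (⟨D', hD'⟩ : P.FullSubcategory)) g'
      let ψ : j ⟶ k := CostructuredArrow.homMk (ObjectProperty.homMk t) htg
      have hψ : (Φ.map ψ).hom = coequalizer.π f₁ f₂ ≫ s := ht.symm
      rw [← colimit.w Φ ψ, Comon.comp_hom', hψ]
      have : f₁ ≫ coequalizer.π f₁ f₂ ≫ s = f₂ ≫ coequalizer.π f₁ f₂ ≫ s := by
        rw [coequalizer.condition_assoc]
      exact (Category.assoc _ _ _).symm.trans
        (congr($this ≫ (colimit.ι Φ k).hom).trans (Category.assoc _ _ _))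
    -- For a monomorphism it remains to lift maps from presentable `Y` to `C`; these are enlarged to
    -- comonoids starting from the initial comonoid.
    have : IsIso φ.hom := hV.isIso_of_mono _ fun Y hY g ↦ by
      have hD : P (⊥_ (Comon V)) := by
        have := isClosedUnderColimitsOfShape_comonProperty (V := V) κ
          (A := Discrete PEmpty.{1}) (hasCardinalLT_of_finite _ _
            (Cardinal.IsRegular.aleph0_le Fact.out))
        exact P.prop_colimit (Functor.empty.{0} _) fun j ↦ j.as.elim
      have hI : IsInitial ((Comon.forget V).obj (⊥_ (Comon V))) :=
        initialIsInitial.isInitialObj _ _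
      obtain ⟨D', hD', g', s, t, hs, ht⟩ := exists_presentable_comon hκ (initial.to C) hD hY
        (hI.to Y) g (hI.hom_ext _ _)
      let k : CostructuredArrow P.ι C :=
        CostructuredArrow.mk (S := P.ι) (Y := (⟨D', hD'⟩ : P.FullSubcategory)) g'
      refine ⟨s ≫ (colimit.ι Φ k).hom, ?_⟩
      exact (Category.assoc _ _ _).trans (congr(s ≫ Comon.Hom.hom $(hφ k)).trans hs)
    have : IsIso ((Comon.forget V).map φ) := this
    have : IsIso φ := isIso_of_reflects_iso φ (Comon.forget V)
    exact ⟨IsColimit.ofIsoColimit (colimit.isColimit _) (Cocone.ext (@asIso _ _ _ _ φ this)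
      fun _ ↦ colimit.ι_desc _ _)⟩

end Dense

/-! ### Representability of limit-preserving presheaves. -/

section Representability

variable {D : Type u} [Category.{v} D]

/-- The inclusion of the elements of a presheaf over objects satisfying `P`. -/
def elementsInclusion (P : ObjectProperty D) (F : Dᵒᵖ ⥤ Type v) :
    (P.ι.op ⋙ F).Elements ⥤ F.Elements where
  obj x := ⟨P.ι.op.obj x.1, x.2⟩
  map f := ⟨P.ι.op.map f.1, f.2⟩

variable [HasColimitsOfSize.{v, v} D]

/-- A presheaf on a cocomplete category with an essentially small dense subcategory is
representable if it sends colimits to limits. -/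
theorem isRepresentable_of_isDense (P : ObjectProperty D) [ObjectProperty.EssentiallySmall.{v} P]
    [P.ι.IsDense] (F : Dᵒᵖ ⥤ Type v) [PreservesLimitsOfSize.{v, v} F] : F.IsRepresentable := by
  have : HasLimitsOfSize.{v, v} F.Elements := ⟨inferInstance⟩
  have : EssentiallySmall.{v} (P.ι.op ⋙ F).Elements := inferInstance
  have : HasLimitsOfShape (P.ι.op ⋙ F).Elements F.Elements :=
    hasLimitsOfShape_of_essentiallySmall _ _
  let H := elementsInclusion P F
  -- The limit of all elements over `P` is weakly initial: its projections at the restrictions of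
  -- `x` form a cocone on the canonical diagram of `C`, hence a map out of `C`. The elements agree
  -- because `F` sends that colimit to a limit.
  have hT (X : F.Elements) : Nonempty (limit H ⟶ X) := by
    obtain ⟨⟨C⟩, x⟩ := X
    let e (k : CostructuredArrow P.ι C) : (P.ι.op ⋙ F).Elements :=
      ⟨op k.left, F.map k.hom.op x⟩
    let c : Cocone (CostructuredArrow.proj P.ι C ⋙ P.ι) :=
      ⟨(limit H).1.unop,
        { app k := (limit.π H (e k)).1.unop
          naturality k l f := by
            let a : e l ⟶ e k := ⟨f.left.op, by
              have := congr(F.map (Quiver.Hom.op $(CostructuredArrow.w f)) x)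
              rw [op_comp, F.map_comp] at this
              exact this⟩
            exact congr(($(limit.w H a)).1.unop).trans (Category.comp_id _).symm }⟩
    have hC := P.ι.denseAt C
    let h : C ⟶ (limit H).1.unop := hC.desc c
    have : PreservesLimitsOfShape (CostructuredArrow P.ι C)ᵒᵖ F :=
      preservesLimitsOfShape_of_equiv (equivSmallModel.{v} (CostructuredArrow P.ι C)ᵒᵖ).symm _
    refine ⟨⟨h.op, Concrete.isLimit_ext _ (isLimitOfPreserves F hC.op) _ _ fun ⟨k⟩ ↦ ?_⟩⟩
    have h₁ : k.hom ≫ h = (limit.π H (e k)).1.unop := by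
      refine Eq.trans ?_ (hC.fac c k)
      congr 1
      exact (Category.id_comp _).symm
    have h₂ : F.map k.hom.op (F.map h.op (limit H).2) = F.map k.hom.op x := by
      refine Eq.trans ?_ (limit.π H (e k)).2
      have := congr(F.map (Quiver.Hom.op $h₁) (limit H).2)
      rw [op_comp, F.map_comp] at this
      exact this
    have h₃ : F.map (𝟙 (P.ι.obj k.left) ≫ k.hom).op = F.map k.hom.op :=
      congr(F.map (Quiver.Hom.op $(Category.id_comp k.hom)))
    exact congr($h₃ _).trans (h₂.trans congr($h₃ x).symm)
  have := hasInitial_of_weakly_initial_and_hasWideEqualizers hT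
  exact Functor.Elements.isRepresentable_of_hasInitial F

end Representability

/-! ### Measurings and the existence of `P(B, A)`. -/

section Measuring

open MonoidalClosed

variable {V : Type u} [Category.{v} V] [MonoidalCategory V] [SymmetricCategory V]

/-- A measuring `ψ : C ⊗ B ⟶ A`, where `C` is a comonoid, and `B` and `A` are monoids: in elements,
`c (1) = ε (c) • 1` and `c (x * y) = ∑ c₁ (x) * c₂ (y)`. -/
structure IsMeasuring {C B A : V} [ComonObj C] [MonObj B] [MonObj A] (ψ : C ⊗ B ⟶ A) : Prop where
  one : C ◁ η[B] ≫ ψ = convOne C A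
  mul : C ◁ μ[B] ≫ ψ = convMul ψ ψ

variable {C B A : V} [ComonObj C] [MonObj B] [MonObj A]

/-- Together with `mul_of_pre`, this allows the measuring axioms to be checked along the legs of a
colimit of comonoids. -/
lemma one_of_pre {C' : V} [ComonObj C'] (k : C' ⟶ C) [IsComonHom k] {ψ : C ⊗ B ⟶ A}
    (h : IsMeasuring (k ▷ B ≫ ψ)) : k ▷ 𝟙_ V ≫ C ◁ η[B] ≫ ψ = k ▷ 𝟙_ V ≫ convOne C A := by
  rw [← whisker_exchange_assoc, h.one, convOne_pre]

lemma mul_of_pre {C' : V} [ComonObj C'] (k : C' ⟶ C) [IsComonHom k] {ψ : C ⊗ B ⟶ A}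
    (h : IsMeasuring (k ▷ B ≫ ψ)) : k ▷ (B ⊗ B) ≫ C ◁ μ[B] ≫ ψ = k ▷ (B ⊗ B) ≫ convMul ψ ψ := by
  rw [← whisker_exchange_assoc, h.mul, convMul_pre]

variable [MonoidalClosed V]

/-- The monoid morphism to the convolution monoid given by a measuring. -/
noncomputable def IsMeasuring.toHom {ψ : C ⊗ B ⟶ A} (h : IsMeasuring ψ) :
    Mon.mk B ⟶ convMon (Comon.mk C) (Mon.mk A) :=
  { hom := curry ψ
    isMonHom_hom :=
      letI := convMonObj C A
      { one_hom := by
          change η[B] ≫ curry ψ = curry (convOne C A)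
          rw [← curry_natural_left, h.one]
        mul_hom := by
          change μ[B] ≫ curry ψ = (curry ψ ⊗ₘ curry ψ) ≫ curry (convMul _ _)
          apply uncurry_injective
          rw [uncurry_conv, uncurry_natural_left, uncurry_curry, h.mul] } }

lemma isMeasuring_uncurry {C : Comon V} (f : Mon.mk B ⟶ convMon C (Mon.mk A)) :
    IsMeasuring (uncurry (A := C.X) (X := A) (Y := B) f.hom) where
  one := by
    have : η[B] ≫ f.hom = curry (convOne C.X A) := IsMonHom.one_hom f.hom
    exact (uncurry_natural_left (A := C.X) _ _).symm.trans
      (congr(uncurry $this).trans (uncurry_curry _))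
  mul := by
    have : μ[B] ≫ f.hom = (f.hom ⊗ₘ f.hom) ≫ curry (convMul _ _) := IsMonHom.mul_hom f.hom
    exact (uncurry_natural_left (A := C.X) _ _).symm.trans
      (congr(uncurry $this).trans (uncurry_conv _ _))

lemma uncurry_convFunctor_map {C D : Comon V} (k : D ⟶ C) (f : Mon.mk B ⟶ convMon C (Mon.mk A)) :
    uncurry (A := D.X) (X := A) (Y := B) (f ≫ (convFunctor (Mon.mk A)).map k.op).hom =
      k.hom ▷ B ≫ uncurry (A := C.X) (X := A) (Y := B) f.hom :=
  uncurry_pre_app (A := C.X) (Y := B) (X := A) f.hom k.hom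

lemma hom_convMon_ext {C : Comon V} {f g : Mon.mk B ⟶ convMon C (Mon.mk A)}
    (h : uncurry (A := C.X) (X := A) (Y := B) f.hom =
      uncurry (A := C.X) (X := A) (Y := B) g.hom) : f = g :=
  Mon.Hom.ext (uncurry_injective h)

lemma uncurry_toHom {ψ : C ⊗ B ⟶ A} (h : IsMeasuring ψ) :
    uncurry (A := C) (X := A) (Y := B) h.toHom.hom = ψ :=
  uncurry_curry ψ

section Limits

/-- Compatible measurings glue to a map out of the colimit tensored with `B`. The axioms are
equations out of the colimit tensored with `𝟙_ V` and `B ⊗ B`, where the legs are again jointly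
epimorphic. -/
instance preservesLimits_convFunctor_coyoneda [HasColimitsOfSize.{v, v} V] :
    PreservesLimitsOfSize.{v, v}
      (convFunctor (Mon.mk A) ⋙ coyoneda.obj (op (Mon.mk B))) where
  preservesLimitsOfShape {J _} := ⟨fun {K} ↦ ⟨fun {c} hc ↦ by
    have hT (X : V) {T : V} {g h : c.pt.unop.X ⊗ X ⟶ T}
        (w : ∀ j, (c.π.app j).unop.hom ▷ X ≫ g = (c.π.app j).unop.hom ▷ X ≫ h) : g = h :=
      (isColimitOfPreserves (Comon.forget V ⋙ tensorRight X)
        (isColimitCoconeLeftOpOfCone _ hc)).hom_ext fun j ↦ w j.unop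
    rw [Types.isLimit_iff]
    intro s hs
    let ψ (j : J) : (K.obj j).unop.X ⊗ B ⟶ A :=
      uncurry (A := (K.obj j).unop.X) (X := A) (Y := B) (s j).hom
    have hψ (j : J) : IsMeasuring (ψ j) := isMeasuring_uncurry (s j)
    let d : Cocone (K.leftOp ⋙ Comon.forget V ⋙ tensorRight B) :=
      ⟨A, { app j := ψ j.unop
            naturality i j f := by
              have := congr(uncurry (A := (K.obj i.unop).unop.X) (X := A) (Y := B)
                (Mon.Hom.hom $(hs f.unop)))
              refine ((uncurry_convFunctor_map _ _).symm.trans this).trans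
                (Category.comp_id _).symm }⟩
    have hB := isColimitOfPreserves (Comon.forget V ⋙ tensorRight B)
      (isColimitCoconeLeftOpOfCone _ hc)
    let φ : c.pt.unop.X ⊗ B ⟶ A := hB.desc d
    have hφ (j : J) : (c.π.app j).unop.hom ▷ B ≫ φ = ψ j := hB.fac d (op j)
    have h : IsMeasuring φ :=
      { one := hT _ fun j ↦ one_of_pre (c.π.app j).unop.hom (by rw [hφ]; exact hψ j)
        mul := hT _ fun j ↦ mul_of_pre (c.π.app j).unop.hom (by rw [hφ]; exact hψ j) }
    refine ⟨h.toHom, fun j ↦ hom_convMon_ext ?_, fun f hf ↦ hom_convMon_ext (hT _ fun j ↦ ?_)⟩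
    · refine (uncurry_convFunctor_map _ _).trans ?_
      rw [uncurry_toHom]
      exact hφ j
    · rw [uncurry_toHom, hφ]
      refine (uncurry_convFunctor_map _ _).symm.trans ?_
      exact congr(uncurry (A := (K.obj j).unop.X) (X := A) (Y := B) (Mon.Hom.hom $(hf j)))⟩⟩

end Limits

/-- Universal measuring comonoids exist in locally presentable symmetric monoidal closed
categories. -/
theorem exists_universalMeasuring [IsLocallyPresentable.{v} V] (B A : V) [MonObj B] [MonObj A] :
    ∃ P : Comon V, Nonempty (UniversalMeasuring P B A) := by
  obtain ⟨κ₀, _, _⟩ := IsLocallyPresentable.exists_cardinal.{v} V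
  -- The successor of `κ₀` is regular and uncountable even when `κ₀` is `ℵ₀`.
  obtain ⟨κ, hκ, h₀, h₁⟩ : ∃ (κ : Cardinal.{v}) (_ : Fact κ.IsRegular),
      κ₀ ≤ κ ∧ Cardinal.aleph0 < κ :=
    have h := Cardinal.IsRegular.aleph0_le (c := κ₀) Fact.out
    ⟨_, ⟨Cardinal.isRegular_succ h⟩, Order.le_succ _, h.trans_lt (Order.lt_succ _)⟩
  have := IsCardinalLocallyPresentable.of_le V h₀
  have := isDense_comonProperty (V := V) h₁
  have := isRepresentable_of_isDense (comonProperty (isCardinalPresentable V κ))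
    (convFunctor (Mon.mk A) ⋙ coyoneda.obj (op (Mon.mk B)))
  exact this.has_representation

end Measuring

/-! ### Coherence of the middle-four interchange. -/

section Coherence

variable {V : Type u} [Category.{v} V] [MonoidalCategory V] [SymmetricCategory V]

/-- This is the compatibility of `tensor V` with braidings; it relies on the two middle crossings
cancelling, hence on symmetry. -/
lemma tensorμ_braiding (X₁ X₂ Y₁ Y₂ : V) :
    tensorμ X₁ X₂ Y₁ Y₂ ≫ ((β_ X₁ Y₁).hom ⊗ₘ (β_ X₂ Y₂).hom) =
      (β_ (X₁ ⊗ X₂) (Y₁ ⊗ Y₂)).hom ≫ tensorμ Y₁ Y₂ X₁ X₂ := by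
  have key : Y₁ ◁ (β_ Y₂ X₁).inv ▷ X₂ ≫ Y₁ ◁ (β_ X₁ Y₂).inv ▷ X₂ = 𝟙 _ := by
    rw [← MonoidalCategory.whiskerLeft_comp, ← comp_whiskerRight]
    simp [← SymmetricCategory.braiding_swap_eq_inv_braiding]
  simp only [tensorμ, SymmetricCategory.braiding_swap_eq_inv_braiding,
    MonoidalCategory.tensorHom_def', Category.assoc]
  simp [reassoc_of% key]

/-- The componentwise braiding on `V × V`. -/
abbrev braidedProd : BraidedCategory (V × V) where
  braiding X Y := Iso.prod (β_ X.1 Y.1) (β_ X.2 Y.2)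
  braiding_naturality_right X _ _ f := by ext <;> simp
  braiding_naturality_left f X := by ext <;> simp
  hexagon_forward X Y Z := by ext <;> simp
  hexagon_reverse X Y Z := by ext <;> simp

attribute [local instance] braidedProd

instance : (tensor V).LaxBraided where
  braided _ _ := tensorμ_braiding _ _ _ _

lemma tensorμ_tensorμ (X₁ X₂ Y₁ Y₂ : V) :
    tensorμ X₁ X₂ Y₁ Y₂ ≫ tensorμ X₁ Y₁ X₂ Y₂ = 𝟙 _ := by
  rw [← tensorμ_tensorδ X₁ X₂ Y₁ Y₂]
  simp [tensorμ, tensorδ, SymmetricCategory.braiding_swap_eq_inv_braiding]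

lemma tensorμ_tensorμ_assoc (X₁ X₂ Y₁ Y₂ : V) {Z : V} (f : (X₁ ⊗ X₂) ⊗ (Y₁ ⊗ Y₂) ⟶ Z) :
    tensorμ X₁ X₂ Y₁ Y₂ ≫ tensorμ X₁ Y₁ X₂ Y₂ ≫ f = f := by
  rw [← Category.assoc, tensorμ_tensorμ, Category.id_comp]

lemma tensorHom_braiding_tensorμ (C D X Y : V) :
    ((β_ C D).hom ⊗ₘ (β_ X Y).hom) ≫ tensorμ D C Y X =
      tensorμ C D X Y ≫ (β_ (C ⊗ X) (D ⊗ Y)).hom := by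
  have h := tensorμ C D X Y ≫= tensorμ_braiding C X D Y =≫ tensorμ D C Y X
  simpa [tensorμ_tensorμ, tensorμ_tensorμ_assoc] using h

lemma tensorμ_comp_tensorHom_tensorμ_comp_tensorμ (C C' D D' E E' F F' : V) :
    tensorμ (C ⊗ C') (D ⊗ D') (E ⊗ E') (F ⊗ F') ≫ (tensorμ C C' E E' ⊗ₘ tensorμ D D' F F') ≫
        tensorμ (C ⊗ E) (C' ⊗ E') (D ⊗ F) (D' ⊗ F') =
      (tensorμ C C' D D' ⊗ₘ tensorμ E E' F F') ≫ tensorμ (C ⊗ D) (C' ⊗ D') (E ⊗ F) (E' ⊗ F') ≫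
        (tensorμ C D E F ⊗ₘ tensorμ C' D' E' F') := by
  have := tensorμ_comp_μ_tensorHom_μ_comp_μ (tensor V) (C, C') (D, D') (E, E') (F, F')
  simp at this
  exact this

end Coherence

lemma isMonHom_one {V : Type u} [Category.{v} V] [MonoidalCategory V] (A : V)
    [MonObj A] : IsMonHom η[A] where
  mul_hom := by simp [unitors_equal]

/-! ### Tensor and pointwise products of measurings. -/

section Tensor

variable {V : Type u} [Category.{v} V] [MonoidalCategory V] [SymmetricCategory V]

/-- Both sides permute the same eight factors, which is the coherence of `tensorμ` for a lax braided
functor. -/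
lemma convMul_tensor {C D A A' X X' Y Y' : V} [ComonObj C] [ComonObj D] [MonObj A] [MonObj A']
    (φ : C ⊗ X ⟶ A) (φ' : C ⊗ X' ⟶ A) (ψ : D ⊗ Y ⟶ A') (ψ' : D ⊗ Y' ⟶ A') :
    convMul (tensorμ C D X Y ≫ (φ ⊗ₘ ψ)) (tensorμ C D X' Y' ≫ (φ' ⊗ₘ ψ')) =
      (C ⊗ D) ◁ tensorμ X Y X' Y' ≫ tensorμ C D (X ⊗ X') (Y ⊗ Y') ≫
        (convMul φ φ' ⊗ₘ convMul ψ ψ') := by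
  have h := tensorμ_comp_tensorHom_tensorμ_comp_tensorμ C C D D X X' Y Y' =≫
    tensorμ (C ⊗ X) (D ⊗ Y) (C ⊗ X') (D ⊗ Y')
  simp only [Category.assoc, tensorμ_tensorμ, Category.comp_id] at h
  have h₁ : ((φ ⊗ₘ ψ) ⊗ₘ (φ' ⊗ₘ ψ')) ≫ μ[A ⊗ A'] =
      tensorμ (C ⊗ X) (D ⊗ Y) (C ⊗ X') (D ⊗ Y') ≫
        (((φ ⊗ₘ φ') ≫ μ[A]) ⊗ₘ ((ψ ⊗ₘ ψ') ≫ μ[A'])) := by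
    rw [MonObj.tensorObj.mul_def, tensorμ_natural_assoc, tensorHom_comp_tensorHom]
  have h₂ : (tensorμ C C D D ▷ ((X ⊗ Y) ⊗ (X' ⊗ Y'))) ≫
      tensorμ (C ⊗ D) (C ⊗ D) (X ⊗ Y) (X' ⊗ Y') ≫
        (tensorμ C D X Y ⊗ₘ tensorμ C D X' Y') ≫ tensorμ (C ⊗ X) (D ⊗ Y) (C ⊗ X') (D ⊗ Y') =
      ((C ⊗ C) ⊗ (D ⊗ D)) ◁ tensorμ X Y X' Y' ≫ tensorμ (C ⊗ C) (D ⊗ D) (X ⊗ X') (Y ⊗ Y') ≫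
        (tensorμ C C X X' ⊗ₘ tensorμ D D Y Y') := by
    rw [h, MonoidalCategory.tensorHom_def' (tensorμ C C D D), Category.assoc,
      ← MonoidalCategory.whiskerLeft_comp_assoc, tensorμ_tensorμ, MonoidalCategory.whiskerLeft_id,
      Category.id_comp]
  simp only [convMul]
  rw [← tensorHom_comp_tensorHom_assoc, h₁, Comon.tensorObj_comul, comp_whiskerRight,
    Category.assoc, reassoc_of% h₂, tensorHom_comp_tensorHom, ← whisker_exchange_assoc,
    tensorμ_natural_left_assoc, tensorHom_comp_tensorHom]

lemma IsMeasuring.tensor {C D A A' B B' : V} [ComonObj C] [ComonObj D] [MonObj A] [MonObj A']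
    [MonObj B] [MonObj B'] {φ : C ⊗ B ⟶ A} {ψ : D ⊗ B' ⟶ A'} (hφ : IsMeasuring φ)
    (hψ : IsMeasuring ψ) : IsMeasuring (tensorμ C D B B' ≫ (φ ⊗ₘ ψ)) where
  one := by
    rw [MonObj.tensorObj.one_def, MonoidalCategory.whiskerLeft_comp, Category.assoc,
      tensorμ_natural_right_assoc, tensorHom_comp_tensorHom, hφ.one, hψ.one]
    have := rightUnitor_monoidal C D
    simp only [convOne, Comon.tensorObj_counit, MonObj.tensorObj.one_def]
    rw [← tensorHom_comp_tensorHom, this, Category.assoc, tensorμ_tensorμ_assoc, Category.assoc,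
      ← MonoidalCategory.whiskerLeft_comp_assoc, Iso.inv_hom_id]
    simp
  mul := by
    rw [convMul_tensor, MonObj.tensorObj.mul_def, MonoidalCategory.whiskerLeft_comp,
      Category.assoc, tensorμ_natural_right_assoc, tensorHom_comp_tensorHom, hφ.mul, hψ.mul]

lemma IsMeasuring.comp_left {C A B B' : V} [ComonObj C] [MonObj A] [MonObj B] [MonObj B']
    {ψ : C ⊗ B ⟶ A} (h : IsMeasuring ψ) (f : B' ⟶ B) [IsMonHom f] :
    IsMeasuring (C ◁ f ≫ ψ) where
  one := by
    rw [← MonoidalCategory.whiskerLeft_comp_assoc, IsMonHom.one_hom, h.one]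
  mul := by
    rw [← MonoidalCategory.whiskerLeft_comp_assoc, IsMonHom.mul_hom,
      MonoidalCategory.whiskerLeft_comp_assoc, h.mul, convMul_natural]

lemma IsMeasuring.comp_right {C A A' B : V} [ComonObj C] [MonObj A] [MonObj A'] [MonObj B]
    {ψ : C ⊗ B ⟶ A} (h : IsMeasuring ψ) (g : A ⟶ A') [IsMonHom g] :
    IsMeasuring (ψ ≫ g) where
  one := by
    rw [reassoc_of% h.one]
    simp [convOne]
  mul := by
    rw [reassoc_of% h.mul]
    simp [convMul, ← tensorHom_comp_tensorHom_assoc]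

attribute [local instance] ComonObj.instTensorUnit

lemma isMeasuring_leftUnitor (B : V) [MonObj B] : IsMeasuring (λ_ B).hom where
  one := by simp [convOne, unitors_equal]
  mul := by
    rw [convMul, leftUnitor_monoidal_assoc, tensorμ_tensorμ_assoc, ComonObj.instTensorUnit_comul,
      ← comp_whiskerRight_assoc, Iso.inv_hom_id]
    simp

lemma isMonHom_mul (A : V) [MonObj A] [IsCommMonObj A] : IsMonHom μ[A] where
  one_hom := by simp [MonObj.tensorObj.one_def, ← unitors_equal]
  mul_hom := by simp [MonObj.tensorObj.mul_def, MonObj.mul_mul_mul_comm]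

lemma isMonHom_comul (B : V) [BimonObj B] : IsMonHom Δ[B] where
  mul_hom := by rw [BimonObj.mul_comul, MonObj.tensorObj.mul_def]

lemma isMonHom_counit (B : V) [BimonObj B] : IsMonHom ε[B] where
  mul_hom := by simp

/-- The pointwise product of `φ : C ⊗ B ⟶ A` and `ψ : D ⊗ B ⟶ A`: in elements,
`(c ⊗ d) ⊗ b ↦ ∑ φ (c ⊗ b₁) * ψ (d ⊗ b₂)`. -/
def pointwiseMul {C D B A : V} [ComonObj B] [MonObj A] (φ : C ⊗ B ⟶ A) (ψ : D ⊗ B ⟶ A) :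
    (C ⊗ D) ⊗ B ⟶ A :=
  (C ⊗ D) ◁ Δ[B] ≫ tensorμ C D B B ≫ (φ ⊗ₘ ψ) ≫ μ[A]

/-- The pointwise product is the tensor product measuring, composed with the monoid morphisms `Δ[B]`
and `μ[A]`. -/
lemma IsMeasuring.pointwiseMul {C D B A : V} [ComonObj C] [ComonObj D] [BimonObj B] [MonObj A]
    [IsCommMonObj A] {φ : C ⊗ B ⟶ A} {ψ : D ⊗ B ⟶ A} (hφ : IsMeasuring φ) (hψ : IsMeasuring ψ) :
    IsMeasuring (pointwiseMul φ ψ) := by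
  have := isMonHom_mul A
  have := isMonHom_comul B
  have := ((hφ.tensor hψ).comp_right μ[A]).comp_left Δ[B]
  rwa [Category.assoc] at this

lemma isMeasuring_one (B A : V) [BimonObj B] [MonObj A] :
    IsMeasuring ((λ_ B).hom ≫ ε[B] ≫ η[A]) := by
  have := isMonHom_one A
  have := isMonHom_counit B
  exact (isMeasuring_leftUnitor B).comp_right (ε[B] ≫ η[A])

section

variable {C D E B A : V} [ComonObj B] [MonObj A]

lemma pointwiseMul_pre {C' D' : V} (k : C' ⟶ C) (l : D' ⟶ D) (φ : C ⊗ B ⟶ A) (ψ : D ⊗ B ⟶ A) :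
    (k ⊗ₘ l) ▷ B ≫ pointwiseMul φ ψ = pointwiseMul (k ▷ B ≫ φ) (l ▷ B ≫ ψ) := by
  unfold pointwiseMul
  rw [← whisker_exchange_assoc, tensorμ_natural_left_assoc, ← tensorHom_comp_tensorHom_assoc]

lemma pointwiseMul_assoc (φ : C ⊗ B ⟶ A) (ψ : D ⊗ B ⟶ A) (χ : E ⊗ B ⟶ A) :
    pointwiseMul (pointwiseMul φ ψ) χ =
      (α_ C D E).hom ▷ B ≫ pointwiseMul φ (pointwiseMul ψ χ) := by
  have e1 : pointwiseMul (pointwiseMul φ ψ) χ =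
      ((C ⊗ D) ⊗ E) ◁ (Δ[B] ≫ Δ[B] ▷ B) ≫ tensorμ (C ⊗ D) E (B ⊗ B) B ≫
        (tensorμ C D B B ▷ (E ⊗ B)) ≫ ((φ ⊗ₘ ψ) ⊗ₘ χ) ≫ (μ[A] ▷ A) ≫ μ[A] := by
    have := tensorμ_natural_right (C ⊗ D) E (Δ[B]) (𝟙 B)
    simp only [MonoidalCategory.whiskerLeft_id, tensorHom_id] at this
    rw [MonoidalCategory.whiskerLeft_comp_assoc, reassoc_of% this]
    simp only [pointwiseMul, ← tensorHom_id, tensorHom_comp_tensorHom_assoc, Category.id_comp,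
      Category.comp_id]
  have e2 : pointwiseMul φ (pointwiseMul ψ χ) =
      (C ⊗ (D ⊗ E)) ◁ (Δ[B] ≫ B ◁ Δ[B]) ≫ tensorμ C (D ⊗ E) B (B ⊗ B) ≫
        ((C ⊗ B) ◁ tensorμ D E B B) ≫ (φ ⊗ₘ (ψ ⊗ₘ χ)) ≫ (A ◁ μ[A]) ≫ μ[A] := by
    have := tensorμ_natural_right C (D ⊗ E) (𝟙 B) (Δ[B])
    simp only [MonoidalCategory.whiskerLeft_id, id_tensorHom] at this
    rw [MonoidalCategory.whiskerLeft_comp_assoc, reassoc_of% this]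
    simp only [pointwiseMul, ← id_tensorHom, tensorHom_comp_tensorHom_assoc, Category.id_comp,
      Category.comp_id]
  rw [e1, e2, MonObj.mul_assoc, associator_naturality_assoc, associator_monoidal_assoc,
    MonoidalCategory.tensorHom_def' (α_ C D E).hom, Category.assoc,
    ← MonoidalCategory.whiskerLeft_comp_assoc, whisker_exchange_assoc, Category.assoc,
    ComonObj.comul_assoc]

lemma one_pointwiseMul (φ : C ⊗ B ⟶ A) :
    pointwiseMul ((λ_ B).hom ≫ ε[B] ≫ η[A]) φ = (λ_ C).hom ▷ B ≫ φ := by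
  have := tensorμ_natural_right (𝟙_ V) C (ε[B]) (𝟙 B)
  simp only [MonoidalCategory.whiskerLeft_id, tensorHom_id] at this
  have h : pointwiseMul ((λ_ B).hom ≫ ε[B] ≫ η[A]) φ =
      (𝟙_ V ⊗ C) ◁ (Δ[B] ≫ ε[B] ▷ B) ≫ tensorμ (𝟙_ V) C (𝟙_ V) B ≫
        ((λ_ (𝟙_ V)).hom ⊗ₘ φ) ≫ (η[A] ▷ A) ≫ μ[A] := by
    rw [MonoidalCategory.whiskerLeft_comp_assoc, reassoc_of% this]
    simp only [pointwiseMul, ← tensorHom_id, tensorHom_comp_tensorHom_assoc, Category.id_comp,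
      Category.comp_id, leftUnitor_naturality_assoc]
  rw [h, MonObj.one_mul, ComonObj.counit_comul]
  have := leftUnitor_monoidal C B
  rw [MonoidalCategory.tensorHom_def (λ_ (𝟙_ V)).hom φ, Category.assoc, leftUnitor_naturality,
    ← reassoc_of% this]
  simp [MonoidalCategory.tensorHom_def']

lemma pointwiseMul_one (φ : C ⊗ B ⟶ A) :
    pointwiseMul φ ((λ_ B).hom ≫ ε[B] ≫ η[A]) = (ρ_ C).hom ▷ B ≫ φ := by
  have := tensorμ_natural_right C (𝟙_ V) (𝟙 B) (ε[B])
  simp only [MonoidalCategory.whiskerLeft_id, id_tensorHom] at this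
  have h : pointwiseMul φ ((λ_ B).hom ≫ ε[B] ≫ η[A]) =
      (C ⊗ 𝟙_ V) ◁ (Δ[B] ≫ B ◁ ε[B]) ≫ tensorμ C (𝟙_ V) B (𝟙_ V) ≫
        (φ ⊗ₘ (λ_ (𝟙_ V)).hom) ≫ (A ◁ η[A]) ≫ μ[A] := by
    rw [MonoidalCategory.whiskerLeft_comp_assoc, reassoc_of% this]
    simp only [pointwiseMul, ← id_tensorHom, tensorHom_comp_tensorHom_assoc, Category.id_comp,
      Category.comp_id]
    simp only [id_tensorHom, leftUnitor_naturality_assoc]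
  rw [h, MonObj.mul_one, ComonObj.comul_counit]
  have := rightUnitor_monoidal C B
  rw [MonoidalCategory.tensorHom_def' φ (λ_ (𝟙_ V)).hom, Category.assoc, rightUnitor_naturality,
    ← reassoc_of% this]
  simp [MonoidalCategory.tensorHom_def']

/-- Swapping the factors amounts to braiding the two copies of `B` and the two values in `A`, which
cocommutativity and commutativity absorb. -/
lemma braiding_pointwiseMul [IsCommComonObj B] [IsCommMonObj A] (φ : C ⊗ B ⟶ A)
    (ψ : D ⊗ B ⟶ A) :
    (β_ C D).hom ▷ B ≫ pointwiseMul ψ φ = pointwiseMul φ ψ := by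
  have h : (C ⊗ D) ◁ Δ[B] ≫ ((β_ C D).hom ⊗ₘ (β_ B B).hom) =
      (β_ C D).hom ▷ B ≫ (D ⊗ C) ◁ Δ[B] := by
    rw [MonoidalCategory.tensorHom_def', ← MonoidalCategory.whiskerLeft_comp_assoc,
      IsCommComonObj.comul_comm, whisker_exchange]
  unfold pointwiseMul
  rw [← reassoc_of% h, reassoc_of% (tensorHom_braiding_tensorμ C D B B),
    ← BraidedCategory.braiding_naturality_assoc, IsCommMonObj.mul_comm]

end

end Tensor

/-! ### Structural comonoid morphisms, to which the universal property applies. -/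

section ComonHom

variable {V : Type u} [Category.{v} V] [MonoidalCategory V] [BraidedCategory V]

lemma isComonHom_tensorHom {C C' D D' : V} [ComonObj C] [ComonObj C'] [ComonObj D] [ComonObj D']
    (k : C ⟶ C') (l : D ⟶ D') [IsComonHom k] [IsComonHom l] : IsComonHom (k ⊗ₘ l) where
  hom_comul := by
    rw [Comon.tensorObj_comul, Comon.tensorObj_comul, Category.assoc, ← tensorμ_natural,
      tensorHom_comp_tensorHom_assoc, tensorHom_comp_tensorHom_assoc, IsComonHom.hom_comul,
      IsComonHom.hom_comul]
  hom_counit := by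
    rw [Comon.tensorObj_counit, Comon.tensorObj_counit, tensorHom_comp_tensorHom_assoc,
      IsComonHom.hom_counit, IsComonHom.hom_counit]

lemma isComonHom_associator (C D E : V) [ComonObj C] [ComonObj D] [ComonObj E] :
    IsComonHom (α_ C D E).hom where
  hom_comul := by
    have h₁ : Δ[(C ⊗ D) ⊗ E] = ((Δ[C] ⊗ₘ Δ[D]) ⊗ₘ Δ[E]) ≫ tensorμ C C D D ▷ (E ⊗ E) ≫
        tensorμ (C ⊗ D) (C ⊗ D) E E := by
      simp only [Comon.tensorObj_comul, ← tensorHom_id, tensorHom_comp_tensorHom_assoc,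
        Category.comp_id]
    have h₂ : Δ[C ⊗ (D ⊗ E)] = (Δ[C] ⊗ₘ (Δ[D] ⊗ₘ Δ[E])) ≫ (C ⊗ C) ◁ tensorμ D D E E ≫
        tensorμ C C (D ⊗ E) (D ⊗ E) := by
      simp only [Comon.tensorObj_comul, ← id_tensorHom, tensorHom_comp_tensorHom_assoc,
        Category.comp_id]
    rw [h₁, h₂, ← associator_naturality_assoc, Category.assoc, Category.assoc,
      tensor_associativity]
  hom_counit := by
    simp only [Comon.tensorObj_counit]
    rw [← Category.comp_id ε[C], ← Category.comp_id ε[E], ← tensorHom_comp_tensorHom,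
      ← tensorHom_comp_tensorHom]
    simp [unitors_equal]

attribute [local instance] ComonObj.instTensorUnit

lemma isComonHom_leftUnitor (C : V) [ComonObj C] : IsComonHom (λ_ C).hom where
  hom_comul := by
    rw [Comon.tensorObj_comul, ComonObj.instTensorUnit_comul, MonoidalCategory.tensorHom_def',
      Category.assoc, Category.assoc, ← tensor_left_unitality, leftUnitor_naturality]

lemma isComonHom_rightUnitor (C : V) [ComonObj C] : IsComonHom (ρ_ C).hom where
  hom_comul := by
    rw [Comon.tensorObj_comul, ComonObj.instTensorUnit_comul, MonoidalCategory.tensorHom_def,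
      Category.assoc, Category.assoc, ← tensor_right_unitality, rightUnitor_naturality]
  hom_counit := by
    simp [unitors_equal]

lemma isComonHom_mul (X : V) [BimonObj X] : IsComonHom μ[X] where
  hom_comul := by rw [BimonObj.mul_comul, Comon.tensorObj_comul, Category.assoc]

lemma isComonHom_one (X : V) [BimonObj X] : IsComonHom η[X] where

end ComonHom

variable {V : Type u} [Category.{v} V] [MonoidalCategory V] [SymmetricCategory V]

lemma isComonHom_braiding (C D : V) [ComonObj C] [ComonObj D] : IsComonHom (β_ C D).hom where
  hom_comul := by
    rw [Comon.tensorObj_comul, Comon.tensorObj_comul, Category.assoc, tensorμ_braiding,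
      ← BraidedCategory.braiding_naturality_assoc]
  hom_counit := by
    rw [Comon.tensorObj_counit, Comon.tensorObj_counit, ← BraidedCategory.braiding_naturality_assoc]
    simp [← unitors_equal]

variable [MonoidalClosed V] {P : Comon V} {B A : V} [MonObj B] [MonObj A]

/-! ### The universal property in terms of evaluation, and the bimonoid structure. -/

namespace UniversalMeasuring

variable (h : UniversalMeasuring P B A)

lemma isMeasuring_eval : IsMeasuring h.eval :=
  isMeasuring_uncurry _

lemma hom_ext {C : V} [ComonObj C] {k l : C ⟶ P.X} [IsComonHom k] [IsComonHom l]
    (w : k ▷ B ≫ h.eval = l ▷ B ≫ h.eval) : k = l := by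
  let K : Comon.mk C ⟶ P := ⟨k⟩
  let L : Comon.mk C ⟶ P := ⟨l⟩
  have : K = L := h.homEquiv.injective (by
    refine (h.homEquiv_eq K).trans (Eq.trans ?_ (h.homEquiv_eq L).symm)
    exact hom_convMon_ext ((uncurry_convFunctor_map K _).trans
      (w.trans (uncurry_convFunctor_map L _).symm)))
  exact congr(Comon.Hom.hom $this)

lemma exists_comonHom {C : V} [ComonObj C] {ψ : C ⊗ B ⟶ A} (hψ : IsMeasuring ψ) :
    ∃ k : C ⟶ P.X, IsComonHom k ∧ k ▷ B ≫ h.eval = ψ := by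
  let K : Comon.mk C ⟶ P := h.homEquiv.symm hψ.toHom
  have hK : h.homEquiv K = hψ.toHom := h.homEquiv.apply_symm_apply _
  refine ⟨K.hom, inferInstance, ?_⟩
  replace hK := (h.homEquiv_eq K).symm.trans hK
  exact (uncurry_convFunctor_map K _).symm.trans
    (congr(MonoidalClosed.uncurry (A := C) (X := A) (Y := B) (Mon.Hom.hom $hK)).trans
      (uncurry_toHom hψ))

end UniversalMeasuring

section Bimonoid

variable {P : Comon V} {B A : V} [BimonObj B] [MonObj A] (h : UniversalMeasuring P B A)

attribute [local instance] ComonObj.instTensorUnit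

/-- A multiplication and a unit on a universal measuring comonoid which are comonoid morphisms and
are pointwise make it a bimonoid. -/
abbrev bimonObjOfEval (m : P.X ⊗ P.X ⟶ P.X) (u : 𝟙_ V ⟶ P.X) [IsComonHom m] [IsComonHom u]
    (hm : m ▷ B ≫ h.eval = pointwiseMul h.eval h.eval)
    (hu : u ▷ B ≫ h.eval = (λ_ B).hom ≫ ε[B] ≫ η[A]) : BimonObj P.X where
  one := u
  mul := m
  one_mul := by
    have := isComonHom_leftUnitor P.X
    have := isComonHom_tensorHom u (𝟙 P.X)
    rw [← tensorHom_id]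
    apply h.hom_ext
    rw [comp_whiskerRight_assoc, hm, pointwiseMul_pre, hu, id_whiskerRight, Category.id_comp,
      one_pointwiseMul]
  mul_one := by
    have := isComonHom_rightUnitor P.X
    have := isComonHom_tensorHom (𝟙 P.X) u
    rw [← id_tensorHom]
    apply h.hom_ext
    rw [comp_whiskerRight_assoc, hm, pointwiseMul_pre, hu, id_whiskerRight, Category.id_comp,
      pointwiseMul_one]
  mul_assoc := by
    have := isComonHom_associator P.X P.X P.X
    have := isComonHom_tensorHom m (𝟙 P.X)
    have := isComonHom_tensorHom (𝟙 P.X) m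
    rw [← tensorHom_id, ← id_tensorHom]
    apply h.hom_ext
    simp only [comp_whiskerRight_assoc, hm, pointwiseMul_pre, id_whiskerRight, Category.id_comp]
    exact pointwiseMul_assoc _ _ _
  mul_comul := by
    rw [IsComonHom.hom_comul, Comon.tensorObj_comul, Category.assoc]
  one_comul := by
    rw [IsComonHom.hom_comul, ComonObj.instTensorUnit_comul]
    rfl
  mul_counit := by
    rw [IsComonHom.hom_counit, Comon.tensorObj_counit]
  one_counit := IsComonHom.hom_counit u

/-- The multiplication and unit of any bimonoid are comonoid morphisms, so their evaluations
determine them. -/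
lemma IsCanonical.eq {S : BimonObj P.X} (hS : IsCanonical h S) {m : P.X ⊗ P.X ⟶ P.X}
    {u : 𝟙_ V ⟶ P.X} [IsComonHom m] [IsComonHom u]
    (hm : m ▷ B ≫ h.eval = pointwiseMul h.eval h.eval)
    (hu : u ▷ B ≫ h.eval = (λ_ B).hom ≫ ε[B] ≫ η[A]) : S = bimonObjOfEval h m u hm hu := by
  -- Unbundling `P` lets its comonoid structure be replaced by that of `S`, so that `h.hom_ext`
  -- applies to the operations of `S`.
  obtain ⟨X, c⟩ := P
  obtain ⟨hc, hm', hu'⟩ := hS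
  dsimp only at S hc m u
  subst hc
  have := isComonHom_mul X
  have := isComonHom_one X
  have e₁ : S.mul = m := h.hom_ext (hm'.trans hm.symm)
  have e₂ : S.one = u := h.hom_ext (hu'.trans hu.symm)
  subst e₁ e₂
  rfl

lemma existsUnique_isCanonical [IsCommMonObj A] : ∃! S : BimonObj P.X, IsCanonical h S := by
  obtain ⟨m, _, hm⟩ := h.exists_comonHom (h.isMeasuring_eval.pointwiseMul h.isMeasuring_eval)
  obtain ⟨u, _, hu⟩ := h.exists_comonHom (isMeasuring_one B A)
  exact ⟨bimonObjOfEval h m u hm hu, ⟨rfl, hm, hu⟩, fun S hS ↦ hS.eq h hm hu⟩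

lemma IsCanonical.isCommBimon [IsCommMonObj A] [IsCommComonObj B] {S : BimonObj P.X}
    (hS : IsCanonical h S) : IsCommBimon S := by
  obtain ⟨m, _, hm⟩ := h.exists_comonHom (h.isMeasuring_eval.pointwiseMul h.isMeasuring_eval)
  obtain ⟨u, _, hu⟩ := h.exists_comonHom (isMeasuring_one B A)
  obtain rfl := hS.eq h hm hu
  have := isComonHom_braiding P.X P.X
  have key : (β_ P.X P.X).hom ≫ m = m := by
    apply h.hom_ext
    rw [comp_whiskerRight_assoc, hm, braiding_pointwiseMul]
  exact @IsCommMonObj.mk _ _ _ _ _ (_) key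

end Bimonoid

end Sweedler

theorem mainTheorem5 {V : Type u} [Category.{v} V] [MonoidalCategory V] [SymmetricCategory V]
    [MonoidalClosed V] [IsLocallyPresentable.{v} V] :
    (∀ (B A : V) [BimonObj B] [MonObj A] [IsCommMonObj A],
      (∃ P : Comon V, Nonempty (Sweedler.UniversalMeasuring P B A)) ∧
      ∀ (P : Comon V) (h : Sweedler.UniversalMeasuring P B A),
        (∃! S : BimonObj P.X, Sweedler.IsCanonical h S) ∧
        (IsCommComonObj B →
          ∀ S : BimonObj P.X, Sweedler.IsCanonical h S → Sweedler.IsCommBimon S)) ∧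
    (∀ (B : V) [BimonObj B],
      (∃ P : Comon V, Nonempty (Sweedler.FiniteDual P B)) ∧
      ∀ (P : Comon V) (h : Sweedler.FiniteDual P B),
        (∃! S : BimonObj P.X, Sweedler.IsCanonical h S) ∧
        (IsCommComonObj B →
          ∀ S : BimonObj P.X, Sweedler.IsCanonical h S → Sweedler.IsCommBimon S)) := by
  have key : ∀ (B A : V) [BimonObj B] [MonObj A] [IsCommMonObj A],
      (∃ P : Comon V, Nonempty (Sweedler.UniversalMeasuring P B A)) ∧
      ∀ (P : Comon V) (h : Sweedler.UniversalMeasuring P B A),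
        (∃! S : BimonObj P.X, Sweedler.IsCanonical h S) ∧
        (IsCommComonObj B →
          ∀ S : BimonObj P.X, Sweedler.IsCanonical h S → Sweedler.IsCommBimon S) :=
    fun B A _ _ _ ↦ ⟨Sweedler.exists_universalMeasuring B A, fun P h ↦
      ⟨Sweedler.existsUnique_isCanonical h, fun _ _ hS ↦ hS.isCommBimon h⟩⟩
  exact ⟨key, fun B _ ↦ key B (𝟙_ V)⟩
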